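/- For integers $0\le k\le m$, a finite set $X$ with $|X|=m$ and a family $\mathcal F\subset\binom{X}{k}$, write $\mu(\mathcal F)=|\mathcal F|/\binom{m}{k}$. For $B\subset J\subset X$ let $$\mathcal F_J^B=\{S\setminus B:\ S\in\mathcal F,\ S\cap J=B\}\subset\binom{X\setminus J}{k-|B|},$$ so that $\mu(\mathcal F_J^B)=|\mathcal F_J^B|/\binom{m-|J|}{k-|B|}$. For $\delta>0$ and an integer $h\ge 0$, the family $\mathcal F\subset\binom{X}{k}$ is called $(\delta,h)$-slice-quasirandom if $|\mu(\mathcal F_J^B)-\mu(\mathcal F)|<\delta$ for all $J\subset X$ with $|J|\le h$ and all $B\subset J$ for which $\mu(\mathcal F_J^B)$ is defined, i.e. $0\le k-|B|\le m-|J|$. Lemma. For any $\epsilon,\zeta\in(0,1)$ and any integer $t\ge 1$ there exist $h_0=h_0(\epsilon,\zeta,t)\in\mathbb N$ and $n_0=n_0(\epsilon,\zeta,t)\in\mathbb N$ such that the following holds. Let $n\ge n_0$, let $k_1,k_2$ be integers with $t-1\le k_1,k_2\le(\tfrac12-\zeta)n$, and let $\mathcal A\subset\binom{[n]}{k_1}$,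 $\mathcal B\subset\binom{[n]}{k_2}$ be $(\epsilon/5,h_0)$-slice-quasirandom families with $\mu(\mathcal A)\ge\epsilon$ and $\mu(\mathcal B)\ge\epsilon$. Then there exist $A\in\mathcal A$ and $B\in\mathcal B$ such that $|A\cap B|=t-1$. -/

import Mathlib

open Finset

/-- The uniform measure `μ(F) = |F| / C(|X|, k)` of a family `F` of `k`-element subsets of the
finite ground set `X`; it is meaningful for `k ≤ |X|`. -/
noncomputable def uniformMeasure {α : Type*} (X : Finset α) (k : ℕ) (F : Finset (Finset α)) : ℝ :=
  (F.card : ℝ) / ((X.card.choose k : ℕ) : ℝ)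

/-- The slice `F_J^B = {S \ B : S ∈ F, S ∩ J = B}`. -/
def sliceFamily {α : Type*} [DecidableEq α] (F : Finset (Finset α)) (J B : Finset α) :
    Finset (Finset α) :=
  (F.filter (fun S => S ∩ J = B)).image (fun S => S \ B)

/-- `(δ, h)`-slice-quasirandomness of a family `F` of `k`-element subsets of `X`: for all
`B ⊆ J ⊆ X` with `|J| ≤ h`, the slice `F_J^B`, measured as a family of `(k - |B|)`-element subsets
of `X \ J`, has measure within `δ` of that of `F`. The measure on that layer exists exactly when
`0 ≤ k - |B| ≤ |X \ J|`, so the comparison is required for those `B` only (for all other `B ⊆ J`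
the layer is empty). -/
def SliceQuasirandom {α : Type*} [DecidableEq α] (X : Finset α) (k : ℕ) (δ : ℝ) (h : ℕ)
    (F : Finset (Finset α)) : Prop :=
  ∀ J : Finset α, J ⊆ X → J.card ≤ h →
    ∀ B : Finset α, B ⊆ J → B.card ≤ k → k - B.card ≤ (X \ J).card →
      |uniformMeasure (X \ J) (k - B.card) (sliceFamily F J B) - uniformMeasure X k F| < δ

/-! Fix a set `T` of size `t - 1`. Let `f` be the indicator of those `z` that contain `A \ T` for
some `A ∈ 𝒜` with `T ⊆ A`, and let `g` be its analogue for `ℬ`. If both have mean above 1/2 on the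
uniform cube, then, since complementation preserves that measure, some `z` has `f z = g zᶜ = 1`. The
corresponding `A \ T ⊆ z` and `B \ T ⊆ zᶜ` are disjoint, so `A ∩ B = T`.

The bound 1/2 (`SliceQuasirandom.half_lt_biasedMean`) is a sharp-threshold argument. By the
Margulis-Russo formula and the mean value theorem, the increasing function `f` has total influence
at most `2 / ζ` at some `p` slightly below 1/2. Friedgut's junta theorem, proved here from Bonami's
lemma, makes `f` close in L² to its average over boundedly many coordinates `J`. Quasirandomness
bounds this average below by `2ε/5` on every subcube fixing `J`: by monotonicity only the subcube
with `J` set to zero matters, and there the slice of `𝒜` with trace `T` on `J ∪ T` supplies the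
mass, because a `p`-random set usually has more than `k` elements. A 0-1 function near an average
bounded away from 0 is mostly 1 (`exists_one_sub_le_biasedMean`), and its mean only grows between
`p` and 1/2. -/

/-! ### Fourier analysis on the biased cube. -/

section BiasedCube

variable {ι : Type*} [DecidableEq ι]

/-- The normalized `p`-biased coordinate function. -/
noncomputable def biasedCoord (p : ℝ) (i : ι) (x : Finset ι) : ℝ :=
  if i ∈ x then (1 - p) / √(p * (1 - p)) else -p / √(p * (1 - p))

/-- The `p`-biased Fourier character. -/
noncomputable def biasedChar (p : ℝ) (S x : Finset ι) : ℝ := ∏ i ∈ S, biasedCoord p i x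

/-- The discrete derivative in the direction `i`. -/
def cubeDeriv (i : ι) (f : Finset ι → ℝ) (x : Finset ι) : ℝ := f (insert i x) - f (x.erase i)

theorem biasedCoord_insert_of_ne (p : ℝ) {i j : ι} (h : j ≠ i) (x : Finset ι) :
    biasedCoord p j (insert i x) = biasedCoord p j (x.erase i) := by
  simp [biasedCoord, h]

theorem biasedChar_insert_of_notMem (p : ℝ) {i : ι} {S : Finset ι} (h : i ∉ S) (x : Finset ι) :
    biasedChar p S (insert i x) = biasedChar p S (x.erase i) :=
  prod_congr rfl fun _ hj => biasedCoord_insert_of_ne p (ne_of_mem_of_not_mem hj h) x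

theorem sqrt_mul_one_sub_pos {p : ℝ} (h0 : 0 < p) (h1 : p < 1) : 0 < √(p * (1 - p)) :=
  Real.sqrt_pos.2 (mul_pos h0 (by linarith))

theorem sq_sqrt_mul_one_sub {p : ℝ} (h0 : 0 < p) (h1 : p < 1) :
    √(p * (1 - p)) ^ 2 = p * (1 - p) :=
  Real.sq_sqrt (mul_pos h0 (by linarith)).le

/-- The reproducing kernel of one coordinate. Products of it give Fourier inversion and conditional
expectations, and its positivity makes the latter monotone. -/
theorem one_add_coord_mul_coord {p : ℝ} (h0 : 0 < p) (h1 : p < 1) (i : ι) (x y : Finset ι) :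
    (if i ∈ y then p else 1 - p) * (1 + biasedCoord p i x * biasedCoord p i y) =
      if (i ∈ x ↔ i ∈ y) then 1 else 0 := by
  have hq : 1 - p ≠ 0 := by linarith
  have hs : √(p * (1 - p)) ≠ 0 := (sqrt_mul_one_sub_pos h0 h1).ne'
  have h2 := sq_sqrt_mul_one_sub h0 h1
  by_cases hx : i ∈ x <;> by_cases hy : i ∈ y <;> simp only [biasedCoord, hx, hy, if_true, if_false,
    iff_self, iff_false, not_true, iff_true] <;> field_simp <;> rw [h2] <;> ring

theorem one_add_coord_mul_coord_nonneg {p : ℝ} (h0 : 0 < p) (h1 : p < 1) (i : ι)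
    (x y : Finset ι) : 0 ≤ 1 + biasedCoord p i x * biasedCoord p i y := by
  have h := one_add_coord_mul_coord h0 h1 i x y
  have hw : 0 < if i ∈ y then p else 1 - p := by split_ifs <;> linarith
  refine nonneg_of_mul_nonneg_right (a := if i ∈ y then p else 1 - p) ?_ hw
  rw [h]
  split_ifs <;> norm_num

variable [Fintype ι]

/-- The `p`-biased weight of a point of the discrete cube, points being finsets. -/
noncomputable def biasedWeight (p : ℝ) (x : Finset ι) : ℝ := ∏ i, if i ∈ x then p else 1 - p

/-- The expectation of `f` under the `p`-biased measure. -/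
noncomputable def biasedMean (p : ℝ) (f : Finset ι → ℝ) : ℝ := ∑ x, biasedWeight p x * f x

/-- The `p`-biased Fourier coefficient. -/
noncomputable def biasedCoeff (p : ℝ) (f : Finset ι → ℝ) (S : Finset ι) : ℝ :=
  biasedMean p fun x => f x * biasedChar p S x

theorem biasedWeight_nonneg {p : ℝ} (h0 : 0 ≤ p) (h1 : p ≤ 1) (x : Finset ι) :
    0 ≤ biasedWeight p x :=
  prod_nonneg fun i _ => by split_ifs <;> linarith

theorem sum_prod_ite_mem (u v : ι → ℝ) :
    ∑ x : Finset ι, ∏ i, (if i ∈ x then u i else v i) = ∏ i, (u i + v i) := by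
  rw [Finset.prod_add, powerset_univ]
  refine sum_congr rfl fun x _ => ?_
  rw [prod_ite]
  congr 2 <;> ext <;> simp

theorem biasedMean_one (p : ℝ) : biasedMean p (fun _ : Finset ι => 1) = 1 := by
  simp [biasedMean, biasedWeight, sum_prod_ite_mem]

theorem biasedMean_mono {p : ℝ} (h0 : 0 ≤ p) (h1 : p ≤ 1) {f g : Finset ι → ℝ}
    (h : ∀ x, f x ≤ g x) : biasedMean p f ≤ biasedMean p g :=
  sum_le_sum fun x _ => mul_le_mul_of_nonneg_left (h x) (biasedWeight_nonneg h0 h1 x)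

theorem biasedMean_nonneg {p : ℝ} (h0 : 0 ≤ p) (h1 : p ≤ 1) {f : Finset ι → ℝ}
    (h : ∀ x, 0 ≤ f x) : 0 ≤ biasedMean p f :=
  sum_nonneg fun x _ => mul_nonneg (biasedWeight_nonneg h0 h1 x) (h x)

theorem biasedMean_add (p : ℝ) (f g : Finset ι → ℝ) :
    biasedMean p (fun x => f x + g x) = biasedMean p f + biasedMean p g := by
  simp [biasedMean, mul_add, sum_add_distrib]

theorem biasedMean_const_mul (p c : ℝ) (f : Finset ι → ℝ) :
    biasedMean p (fun x => c * f x) = c * biasedMean p f := by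
  simp only [biasedMean, mul_sum]
  exact sum_congr rfl fun x _ => by ring

theorem biasedMean_sum (p : ℝ) {κ : Type*} (s : Finset κ) (f : κ → Finset ι → ℝ) :
    biasedMean p (fun x => ∑ k ∈ s, f k x) = ∑ k ∈ s, biasedMean p (f k) := by
  simp only [biasedMean, mul_sum]
  exact sum_comm

theorem sq_biasedMean_mul_le {p : ℝ} (h0 : 0 ≤ p) (h1 : p ≤ 1) (f g : Finset ι → ℝ) :
    (biasedMean p fun x => f x * g x) ^ 2 ≤
      (biasedMean p fun x => f x ^ 2) * biasedMean p fun x => g x ^ 2 := by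
  have h := sum_mul_sq_le_sq_mul_sq (univ : Finset (Finset ι))
    (fun x => √(biasedWeight p x) * f x) (fun x => √(biasedWeight p x) * g x)
  have hs : ∀ x : Finset ι, √(biasedWeight p x) ^ 2 = biasedWeight p x :=
    fun x => Real.sq_sqrt (biasedWeight_nonneg h0 h1 x)
  simp only [mul_pow, hs] at h
  refine le_trans (le_of_eq ?_) h
  congr 1
  refine sum_congr rfl fun x _ => ?_
  linear_combination (-f x * g x) * hs x

theorem sum_finset_eq_pairs (i : ι) (F : Finset ι → ℝ) :
    ∑ x, F x = ∑ x ∈ (univ.erase i).powerset, (F x + F (insert i x)) := by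
  have h : (univ : Finset (Finset ι)) = (insert i (univ.erase i)).powerset := by
    rw [insert_erase (mem_univ i), powerset_univ]
  rw [h, sum_powerset_insert (notMem_erase i univ), sum_add_distrib]

theorem biasedWeight_of_notMem (p : ℝ) {i : ι} {x : Finset ι} (h : i ∉ x) :
    biasedWeight p x = (1 - p) * ∏ j ∈ univ.erase i, if j ∈ x then p else 1 - p := by
  rw [biasedWeight, ← mul_prod_erase univ _ (mem_univ i), if_neg h]

theorem biasedWeight_insert (p : ℝ) {i : ι} {x : Finset ι} :
    biasedWeight p (insert i x) = p * ∏ j ∈ univ.erase i, if j ∈ x then p else 1 - p := by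
  rw [biasedWeight, ← mul_prod_erase univ _ (mem_univ i), if_pos (mem_insert_self i x)]
  congr 1
  refine prod_congr rfl fun j hj => ?_
  simp [(mem_erase.1 hj).1]

/-- Resampling coordinate `i`; identities of means then reduce to pointwise ones. -/
theorem biasedMean_eq_mean_section (p : ℝ) (i : ι) (F : Finset ι → ℝ) :
    biasedMean p F = biasedMean p fun x => p * F (insert i x) + (1 - p) * F (x.erase i) := by
  rw [biasedMean, biasedMean, sum_finset_eq_pairs i, sum_finset_eq_pairs i]
  refine sum_congr rfl fun x hx => ?_
  have hi : i ∉ x := fun h => by simpa using mem_powerset.1 hx h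
  rw [biasedWeight_of_notMem p hi, biasedWeight_insert, insert_idem, erase_eq_of_notMem hi,
    erase_insert hi]
  ring

theorem biasedMean_ite_mul (p : ℝ) {i : ι} {g : Finset ι → ℝ}
    (hg : ∀ x, g (insert i x) = g (x.erase i)) (u v : ℝ) :
    biasedMean p (fun x => (if i ∈ x then u else v) * g x) =
      (p * u + (1 - p) * v) * biasedMean p g := by
  rw [biasedMean_eq_mean_section p i, biasedMean_eq_mean_section p i g, ← biasedMean_const_mul]
  congr 1
  funext x
  simp only [mem_insert_self, if_true, notMem_erase, if_false, hg]
  ring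

/-- The hypothesis `hg` says that `g` ignores coordinate `i`, so the mean factors by independence.
-/
theorem biasedMean_pow_mul (p : ℝ) {i : ι} {g : Finset ι → ℝ}
    (hg : ∀ x, g (insert i x) = g (x.erase i)) (k : ℕ) :
    biasedMean p (fun x => biasedCoord p i x ^ k * g x) =
      (p * ((1 - p) / √(p * (1 - p))) ^ k + (1 - p) * (-p / √(p * (1 - p))) ^ k) *
        biasedMean p g := by
  rw [← biasedMean_ite_mul p hg]
  congr 1
  funext x
  unfold biasedCoord
  split_ifs <;> rfl

theorem biasedMean_coord_mul (p : ℝ) {i : ι} {g : Finset ι → ℝ}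
    (hg : ∀ x, g (insert i x) = g (x.erase i)) :
    biasedMean p (fun x => biasedCoord p i x * g x) = 0 := by
  have h := biasedMean_pow_mul p hg 1
  simp only [pow_one] at h
  rw [h]
  ring

theorem biasedMean_coord_sq_mul {p : ℝ} (h0 : 0 < p) (h1 : p < 1) {i : ι} {g : Finset ι → ℝ}
    (hg : ∀ x, g (insert i x) = g (x.erase i)) :
    biasedMean p (fun x => biasedCoord p i x ^ 2 * g x) = biasedMean p g := by
  rw [biasedMean_pow_mul p hg, div_pow, div_pow, sq_sqrt_mul_one_sub h0 h1]
  have : 1 - p ≠ 0 := by linarith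
  have : p * ((1 - p) ^ 2 / (p * (1 - p))) + (1 - p) * ((-p) ^ 2 / (p * (1 - p))) = 1 := by
    field_simp
    ring
  rw [this, one_mul]

theorem biasedMean_char_mul_eq_zero (p : ℝ) {i : ι} {S : Finset ι} (hi : i ∈ S)
    {g : Finset ι → ℝ} (hg : ∀ x, g (insert i x) = g (x.erase i)) :
    biasedMean p (fun x => biasedChar p S x * g x) = 0 := by
  have h := biasedMean_coord_mul p (i := i) (g := fun x => biasedChar p (S.erase i) x * g x)
    fun x => by rw [biasedChar_insert_of_notMem p (notMem_erase i S), hg]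
  rw [← h]
  congr 1
  funext x
  rw [biasedChar, ← mul_prod_erase S _ hi, mul_assoc, biasedChar]

theorem biasedMean_char_sq {p : ℝ} (h0 : 0 < p) (h1 : p < 1) (S : Finset ι) :
    biasedMean p (fun x => biasedChar p S x ^ 2) = 1 := by
  induction S using Finset.induction_on with
  | empty => simpa [biasedChar] using biasedMean_one (ι := ι) p
  | insert i S hi ih =>
    rw [← ih, ← biasedMean_coord_sq_mul h0 h1 (i := i) (g := fun x => biasedChar p S x ^ 2)
      fun x => by rw [biasedChar_insert_of_notMem p hi]]
    congr 1
    funext x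
    rw [biasedChar, prod_insert hi, mul_pow, biasedChar]

theorem biasedMean_char_mul_char {p : ℝ} (h0 : 0 < p) (h1 : p < 1) (S T : Finset ι) :
    biasedMean p (fun x => biasedChar p S x * biasedChar p T x) = if S = T then 1 else 0 := by
  split_ifs with h
  · subst h
    simpa [sq] using biasedMean_char_sq h0 h1 S
  · have : (∃ i ∈ S, i ∉ T) ∨ ∃ i ∈ T, i ∉ S := by
      by_contra! hc
      exact h (Subset.antisymm hc.1 hc.2)
    obtain ⟨i, hi, hi'⟩ | ⟨i, hi, hi'⟩ := this
    · exact biasedMean_char_mul_eq_zero p hi (biasedChar_insert_of_notMem p hi')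
    · simp only [mul_comm (biasedChar p S _)]
      exact biasedMean_char_mul_eq_zero p hi (biasedChar_insert_of_notMem p hi')

theorem biasedMean_sq_sum_char {p : ℝ} (h0 : 0 < p) (h1 : p < 1) (𝒮 : Finset (Finset ι))
    (a : Finset ι → ℝ) :
    biasedMean p (fun x => (∑ S ∈ 𝒮, a S * biasedChar p S x) ^ 2) = ∑ S ∈ 𝒮, a S ^ 2 := by
  have : ∀ x, (∑ S ∈ 𝒮, a S * biasedChar p S x) ^ 2 =
      ∑ S ∈ 𝒮, ∑ T ∈ 𝒮, (a S * a T) * (biasedChar p S x * biasedChar p T x) := fun x => by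
    rw [sq, sum_mul_sum]
    exact sum_congr rfl fun S _ => sum_congr rfl fun T _ => by ring
  simp only [this, biasedMean_sum, biasedMean_const_mul, biasedMean_char_mul_char h0 h1]
  refine sum_congr rfl fun S hS => ?_
  simp [hS, sq]

/-- For `0 < p < 1` this is the conditional expectation of `f` given the coordinates in `J`, in
kernel form. -/
theorem sum_biasedCoeff_powerset (p : ℝ) (f : Finset ι → ℝ) (J x : Finset ι) :
    ∑ S ∈ J.powerset, biasedCoeff p f S * biasedChar p S x =
      biasedMean p fun y => f y * ∏ i ∈ J, (1 + biasedCoord p i x * biasedCoord p i y) := by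
  simp only [prod_one_add, mul_sum, biasedMean_sum]
  refine sum_congr rfl fun S _ => ?_
  rw [biasedCoeff, mul_comm, ← biasedMean_const_mul]
  congr 1
  funext y
  rw [prod_mul_distrib, biasedChar, biasedChar]
  ring

theorem sum_biasedCoeff_char {p : ℝ} (h0 : 0 < p) (h1 : p < 1) (f : Finset ι → ℝ)
    (x : Finset ι) : ∑ S, biasedCoeff p f S * biasedChar p S x = f x := by
  rw [← powerset_univ, sum_biasedCoeff_powerset, biasedMean, sum_eq_single x]
  · rw [biasedWeight, mul_left_comm, ← prod_mul_distrib]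
    simp [one_add_coord_mul_coord h0 h1]
  · intro y _ hy
    obtain ⟨i, hi⟩ : ∃ i, ¬(i ∈ x ↔ i ∈ y) := by
      by_contra! hc
      exact hy (Finset.ext fun i => (hc i).symm)
    rw [biasedWeight, mul_left_comm, ← prod_mul_distrib, prod_eq_zero (mem_univ i), mul_zero]
    rw [one_add_coord_mul_coord h0 h1, if_neg hi]
  · simp

/-- The average of an increasing function over a subcube is at least its average over the subcube
on which the fixed coordinates vanish. -/
theorem biasedMean_sdiff_le {p : ℝ} (h0 : 0 < p) (h1 : p < 1) {f : Finset ι → ℝ}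
    (hf : Monotone f) (J x : Finset ι) :
    biasedMean p (fun y => f (y \ J)) ≤ ∑ S ∈ J.powerset, biasedCoeff p f S * biasedChar p S x := by
  -- Since `y ↦ f (y \ J)` ignores the coordinates in `J`, only its empty coefficient survives the
  -- projection.
  have key : biasedMean p (fun y => f (y \ J)) =
      ∑ S ∈ J.powerset, biasedCoeff p (fun y => f (y \ J)) S * biasedChar p S x := by
    rw [sum_eq_single ∅]
    · simp [biasedCoeff, biasedChar]
    · intro S hS hne
      obtain ⟨i, hi⟩ := nonempty_iff_ne_empty.2 hne
      have hiJ := mem_powerset.1 hS hi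
      rw [biasedCoeff]
      simp only [mul_comm (f _)]
      rw [biasedMean_char_mul_eq_zero p hi (g := fun y => f (y \ J)), zero_mul]
      intro y
      rw [insert_sdiff_of_mem _ hiJ, erase_sdiff_comm, erase_eq_of_notMem]
      simp [hiJ]
    · simp
  rw [key, sum_biasedCoeff_powerset, sum_biasedCoeff_powerset]
  exact biasedMean_mono h0.le h1.le fun y => mul_le_mul_of_nonneg_right (hf sdiff_subset)
    (prod_nonneg fun i _ => one_add_coord_mul_coord_nonneg h0 h1 i x y)

end BiasedCube

/-! ### Bonami's lemma and the level inequality. -/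

section Hypercontractivity

variable {ι : Type*} [Fintype ι] [DecidableEq ι]

/-- Bonami's lemma: the fourth moment of a polynomial on the biased cube. -/
theorem biasedMean_pow_four_le {p : ℝ} (hp : p ∈ Set.Icc (1 / 4 : ℝ) (1 / 2)) (s : Finset ι)
    (a : Finset ι → ℝ) :
    biasedMean p (fun x => (∑ S ∈ s.powerset, a S * biasedChar p S x) ^ 4) ≤
      (∑ S ∈ s.powerset, 9 ^ S.card * a S ^ 2) ^ 2 := by
  obtain ⟨hp1, hp2⟩ := hp
  have h0 : 0 < p := by linarith
  have h1 : p < 1 := by linarith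
  induction s using Finset.induction_on generalizing a with
  | empty =>
    simp only [powerset_empty, sum_singleton, biasedChar, prod_empty, card_empty, pow_zero, one_mul,
      mul_one]
    have := biasedMean_const_mul (ι := ι) p (a ∅ ^ 4) (fun _ => 1)
    simp only [mul_one, biasedMean_one] at this
    rw [this]
    exact le_of_eq (by ring)
  | insert i s hi ih =>
    -- Split the polynomial as `A + χ_i B`, with `A` and `B` independent of coordinate `i`, and
    -- expand the fourth power.
    set A : Finset ι → ℝ := fun x => ∑ S ∈ s.powerset, a S * biasedChar p S x with hA
    set B : Finset ι → ℝ := fun x => ∑ S ∈ s.powerset, a (insert i S) * biasedChar p S x with hB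
    set α : ℝ := ∑ S ∈ s.powerset, 9 ^ S.card * a S ^ 2 with hα
    set β : ℝ := ∑ S ∈ s.powerset, 9 ^ S.card * a (insert i S) ^ 2 with hβ
    have hα0 : 0 ≤ α := sum_nonneg fun S _ => by positivity
    have hβ0 : 0 ≤ β := sum_nonneg fun S _ => by positivity
    have hmem : ∀ S ∈ s.powerset, i ∉ S := fun S hS h => hi (mem_powerset.1 hS h)
    have hsum : ∀ x, ∑ S ∈ (insert i s).powerset, a S * biasedChar p S x =
        A x + biasedCoord p i x * B x := fun x => by
      rw [sum_powerset_insert hi, hA, hB, mul_sum]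
      congr 1
      refine sum_congr rfl fun S hS => ?_
      rw [biasedChar, prod_insert (hmem S hS), ← biasedChar]
      ring
    have hw : ∑ S ∈ (insert i s).powerset, 9 ^ S.card * a S ^ 2 = α + 9 * β := by
      rw [sum_powerset_insert hi, hα, hβ, mul_sum]
      congr 1
      refine sum_congr rfl fun S hS => ?_
      rw [card_insert_of_notMem (hmem S hS)]
      ring
    have hAi : ∀ x, A (insert i x) = A (x.erase i) := fun x =>
      sum_congr rfl fun S hS => by rw [biasedChar_insert_of_notMem p (hmem S hS)]
    have hBi : ∀ x, B (insert i x) = B (x.erase i) := fun x =>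
      sum_congr rfl fun S hS => by rw [biasedChar_insert_of_notMem p (hmem S hS)]
    have e1 := biasedMean_pow_mul p (i := i) (g := fun x => A x ^ 3 * B x)
      (fun x => by rw [hAi, hBi]) 1
    have e2 := biasedMean_coord_sq_mul h0 h1 (i := i) (g := fun x => A x ^ 2 * B x ^ 2)
      (fun x => by rw [hAi, hBi])
    have e3 := biasedMean_pow_mul p (i := i) (g := fun x => A x * B x ^ 3)
      (fun x => by rw [hAi, hBi]) 3
    have e4 := biasedMean_pow_mul p (i := i) (g := fun x => B x ^ 4)
      (fun x => by rw [hBi]) 4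
    have hexp : biasedMean p (fun x => (A x + biasedCoord p i x * B x) ^ 4) =
        biasedMean p (fun x => A x ^ 4) +
        4 * biasedMean p (fun x => biasedCoord p i x ^ 1 * (A x ^ 3 * B x)) +
        6 * biasedMean p (fun x => biasedCoord p i x ^ 2 * (A x ^ 2 * B x ^ 2)) +
        4 * biasedMean p (fun x => biasedCoord p i x ^ 3 * (A x * B x ^ 3)) +
        biasedMean p (fun x => biasedCoord p i x ^ 4 * B x ^ 4) := by
      simp only [← biasedMean_const_mul, ← biasedMean_add]
      congr 1
      funext x
      ring
    set σ := √(p * (1 - p)) with hσ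
    have hσ0 : 0 < σ := sqrt_mul_one_sub_pos h0 h1
    have hσ2 : σ ^ 2 = p * (1 - p) := sq_sqrt_mul_one_sub h0 h1
    -- The range of `p` enters here: it bounds the third moment of a coordinate by 2 and the fourth
    -- by 3.
    have hσ3 : 3 / 16 ≤ σ ^ 2 := by rw [hσ2]; nlinarith
    have hσ4 : 1 / 4 ≤ σ := by nlinarith
    have c1 : p * ((1 - p) / σ) ^ 1 + (1 - p) * (-p / σ) ^ 1 = 0 := by ring
    have c3 : p * ((1 - p) / σ) ^ 3 + (1 - p) * (-p / σ) ^ 3 = (1 - 2 * p) / σ := by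
      rw [div_pow, div_pow, eq_div_iff hσ0.ne']
      field_simp
      rw [hσ2]
      ring
    have c4 : p * ((1 - p) / σ) ^ 4 + (1 - p) * (-p / σ) ^ 4 = (1 - 3 * σ ^ 2) / σ ^ 2 := by
      rw [div_pow, div_pow]
      field_simp
      rw [hσ2]
      ring
    have b3 : (1 - 2 * p) / σ ≤ 2 := by
      rw [div_le_iff₀ hσ0]
      linarith
    have b3' : 0 ≤ (1 - 2 * p) / σ := div_nonneg (by linarith) hσ0.le
    have b4 : (1 - 3 * σ ^ 2) / σ ^ 2 ≤ 3 := by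
      rw [div_le_iff₀ (by positivity)]
      linarith
    rw [c1] at e1
    rw [c3] at e3
    rw [c4] at e4
    simp only [hsum, hw]
    rw [hexp, e1, e2, e3, e4]
    have hA4 : biasedMean p (fun x => A x ^ 4) ≤ α ^ 2 := ih a
    have hB4 : biasedMean p (fun x => B x ^ 4) ≤ β ^ 2 := ih fun S => a (insert i S)
    have hB40 : 0 ≤ biasedMean p (fun x => B x ^ 4) :=
      biasedMean_nonneg h0.le h1.le fun x => by positivity
    have hA40 : 0 ≤ biasedMean p (fun x => A x ^ 4) :=
      biasedMean_nonneg h0.le h1.le fun x => by positivity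
    have hAB : biasedMean p (fun x => A x ^ 2 * B x ^ 2) ≤ α * β := by
      have := sq_biasedMean_mul_le h0.le h1.le (fun x => A x ^ 2) (fun x => B x ^ 2)
      simp only [← pow_mul] at this
      refine abs_le_of_sq_le_sq' ?_ (by positivity) |>.2
      calc _ ≤ _ := this
        _ ≤ α ^ 2 * β ^ 2 := mul_le_mul hA4 hB4 hB40 (by positivity)
        _ = _ := by ring
    have hAB3 : biasedMean p (fun x => A x * B x ^ 3) ≤ (α * β + β ^ 2) / 2 := by
      have : biasedMean p (fun x => A x * B x ^ 3) ≤
          1 / 2 * biasedMean p (fun x => A x ^ 2 * B x ^ 2 + B x ^ 4) := by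
        rw [← biasedMean_const_mul]
        refine biasedMean_mono h0.le h1.le fun x => ?_
        nlinarith [mul_nonneg (sq_nonneg (B x)) (sq_nonneg (A x - B x))]
      rw [biasedMean_add] at this
      linarith
    have hαβ : 0 ≤ α * β := mul_nonneg hα0 hβ0
    have t3 : (1 - 2 * p) / σ * biasedMean p (fun x => A x * B x ^ 3) ≤ α * β + β ^ 2 :=
      calc _ ≤ (1 - 2 * p) / σ * ((α * β + β ^ 2) / 2) := mul_le_mul_of_nonneg_left hAB3 b3'
        _ ≤ 2 * ((α * β + β ^ 2) / 2) := mul_le_mul_of_nonneg_right b3 (by positivity)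
        _ = _ := by ring
    have t4 : (1 - 3 * σ ^ 2) / σ ^ 2 * biasedMean p (fun x => B x ^ 4) ≤ 3 * β ^ 2 :=
      calc _ ≤ 3 * biasedMean p (fun x => B x ^ 4) := mul_le_mul_of_nonneg_right b4 hB40
        _ ≤ _ := by linarith
    -- The bounds add up to at most `α² + 10αβ + 7β²`.
    have hsq : (α + 9 * β) ^ 2 = α ^ 2 + 18 * (α * β) + 81 * β ^ 2 := by ring
    rw [hsq]
    linarith [sq_nonneg β]

theorem biasedMean_mul_sum_char (p : ℝ) (g : Finset ι → ℝ) (𝒮 : Finset (Finset ι))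
    (a : Finset ι → ℝ) :
    biasedMean p (fun x => g x * ∑ S ∈ 𝒮, a S * biasedChar p S x) =
      ∑ S ∈ 𝒮, a S * biasedCoeff p g S := by
  simp only [mul_sum, biasedMean_sum, biasedCoeff, ← biasedMean_const_mul]
  refine sum_congr rfl fun S _ => ?_
  congr 1
  funext x
  ring

theorem sum_sq_biasedCoeff {p : ℝ} (h0 : 0 < p) (h1 : p < 1) (f : Finset ι → ℝ) :
    ∑ S, biasedCoeff p f S ^ 2 = biasedMean p fun x => f x ^ 2 := by
  rw [← biasedMean_sq_sum_char h0 h1]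
  simp only [sum_biasedCoeff_char h0 h1]

/-- The level inequality: a small set has little Fourier weight on low levels. -/
theorem sq_sum_sq_biasedCoeff_le {p : ℝ} (hp : p ∈ Set.Icc (1 / 4 : ℝ) (1 / 2))
    {g : Finset ι → ℝ} (hg : ∀ x, g x ^ 2 = g x) {d : ℕ} {𝒮 : Finset (Finset ι)}
    (h𝒮 : ∀ S ∈ 𝒮, S.card ≤ d) :
    (∑ S ∈ 𝒮, biasedCoeff p g S ^ 2) ^ 2 ≤ biasedMean p g ^ 3 * 81 ^ d := by
  have h0 : 0 < p := by linarith [hp.1]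
  have h1 : p < 1 := by linarith [hp.2]
  set w := ∑ S ∈ 𝒮, biasedCoeff p g S ^ 2 with hw
  set α := biasedMean p g with hα
  have hg2 : biasedMean p (fun x => g x ^ 2) = α := by simp only [hg, hα]
  have hw0 : 0 ≤ w := sum_nonneg fun S _ => sq_nonneg _
  have hα0 : 0 ≤ α := hg2 ▸ biasedMean_nonneg h0.le h1.le fun x => sq_nonneg _
  set H : Finset ι → ℝ := fun x => ∑ S ∈ 𝒮, biasedCoeff p g S * biasedChar p S x with hH
  -- Cauchy-Schwarz twice, using `g² = g`, and then Bonami give `w⁴ ≤ α³ 81^d w²`.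
  have hwH : w = biasedMean p (fun x => g x * H x) := by
    rw [hH, biasedMean_mul_sum_char, hw]
    exact sum_congr rfl fun S _ => sq _
  have s1 : w ^ 2 ≤ α * biasedMean p (fun x => g x * H x ^ 2) := by
    have := sq_biasedMean_mul_le h0.le h1.le g (fun x => g x * H x)
    simp only [mul_pow, hg] at this
    rw [hwH]
    refine le_trans (le_of_eq ?_) this
    congr 2
    funext x
    linear_combination (-H x) * hg x
  have s2 : biasedMean p (fun x => g x * H x ^ 2) ^ 2 ≤ α * biasedMean p (fun x => H x ^ 4) := by
    have := sq_biasedMean_mul_le h0.le h1.le g (fun x => H x ^ 2)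
    simpa only [hg, ← pow_mul] using this
  have s3 : biasedMean p (fun x => H x ^ 4) ≤ (9 ^ d * w) ^ 2 := by
    have := biasedMean_pow_four_le hp univ fun S => if S ∈ 𝒮 then biasedCoeff p g S else 0
    simp only [powerset_univ, ite_mul, zero_mul, ite_pow, mul_ite, ne_eq, OfNat.ofNat_ne_zero,
      not_false_eq_true, zero_pow, mul_zero, sum_ite_mem, univ_inter] at this
    refine this.trans (pow_le_pow_left₀ (sum_nonneg fun S _ => by positivity) ?_ 2)
    rw [hw, mul_sum]
    exact sum_le_sum fun S hS => mul_le_mul_of_nonneg_right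
      (pow_le_pow_right₀ (by norm_num) (h𝒮 S hS)) (sq_nonneg _)
  obtain hz | hpos := hw0.eq_or_lt
  · rw [← hz, zero_pow two_ne_zero]
    positivity
  · refine le_of_mul_le_mul_right ?_ (pow_pos hpos 2)
    calc w ^ 2 * w ^ 2 = (w ^ 2) ^ 2 := by ring
      _ ≤ (α * biasedMean p (fun x => g x * H x ^ 2)) ^ 2 := pow_le_pow_left₀ (by positivity) s1 2
      _ = α ^ 2 * biasedMean p (fun x => g x * H x ^ 2) ^ 2 := by ring
      _ ≤ α ^ 2 * (α * (9 ^ d * w) ^ 2) := by gcongr; exact s2.trans (by gcongr)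
      _ = α ^ 3 * 81 ^ d * w ^ 2 := by
        rw [show (81 : ℝ) = 9 ^ 2 by norm_num, ← pow_mul, mul_comm 2 d, pow_mul]
        ring

end Hypercontractivity

/-! ### Friedgut's junta theorem and its consequence. -/

section Junta

variable {ι : Type*} [DecidableEq ι]

/-- The derivative is the indicator that `i` is pivotal, so its mean is both the influence and its
squared L² norm. -/
theorem cubeDeriv_sq_eq {f : Finset ι → ℝ} (hf : Monotone f) (h01 : ∀ x, f x = 0 ∨ f x = 1)
    (i : ι) (x : Finset ι) : cubeDeriv i f x ^ 2 = cubeDeriv i f x := by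
  have h : f (x.erase i) ≤ f (insert i x) := hf ((erase_subset i x).trans (subset_insert i x))
  rw [cubeDeriv]
  obtain h1 | h1 := h01 (x.erase i) <;> obtain h2 | h2 := h01 (insert i x) <;> rw [h1, h2] <;>
    norm_num
  rw [h1, h2] at h
  norm_num at h

variable [Fintype ι]

theorem biasedCoeff_insert {p : ℝ} (h0 : 0 < p) (h1 : p < 1) (f : Finset ι → ℝ) {i : ι}
    {S : Finset ι} (hi : i ∉ S) :
    biasedCoeff p f (insert i S) = √(p * (1 - p)) * biasedCoeff p (cubeDeriv i f) S := by
  have hσ := (sqrt_mul_one_sub_pos h0 h1).ne'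
  have h2 := sq_sqrt_mul_one_sub h0 h1
  rw [biasedCoeff, biasedCoeff, biasedMean_eq_mean_section p i, ← biasedMean_const_mul,
    biasedMean_eq_mean_section p i
      (fun x => √(p * (1 - p)) * (cubeDeriv i f x * biasedChar p S x))]
  congr 1
  funext x
  have hχ : ∀ y, biasedChar p (insert i S) y = biasedCoord p i y * biasedChar p S y :=
    fun y => prod_insert hi
  have hins : insert i (x.erase i) = insert i x := by ext j; by_cases j = i <;> simp_all
  simp only [hχ, biasedChar_insert_of_notMem p hi, cubeDeriv, insert_idem,
    erase_insert_eq_erase, hins, erase_idem]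
  simp only [biasedCoord, mem_insert_self, notMem_erase, if_true, if_false]
  field_simp
  rw [h2]
  ring

/-- Removing `i` from each character turns this weight into weight of the derivative, one level
lower. -/
theorem sum_biasedCoeff_sq_mem {p : ℝ} (h0 : 0 < p) (h1 : p < 1) (f : Finset ι → ℝ) (i : ι)
    (P : ℕ → Prop) [DecidablePred P] :
    ∑ S, (if i ∈ S ∧ P S.card then biasedCoeff p f S ^ 2 else 0) =
      p * (1 - p) * ∑ S ∈ (univ.erase i).powerset with P (S.card + 1),
        biasedCoeff p (cubeDeriv i f) S ^ 2 := by
  rw [sum_finset_eq_pairs i, mul_sum, sum_filter]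
  refine sum_congr rfl fun S hS => ?_
  have hi : i ∉ S := fun h => by simpa using mem_powerset.1 hS h
  simp [hi, biasedCoeff_insert h0 h1, mul_pow, sq_sqrt_mul_one_sub h0 h1]

/-- Summing over `i` counts each `S` exactly `|S|` times; the factor `p (1 - p)` is dropped. -/
theorem sum_card_mul_sq_biasedCoeff_le {p : ℝ} (h0 : 0 < p) (h1 : p < 1) {f : Finset ι → ℝ}
    (hf : Monotone f) (h01 : ∀ x, f x = 0 ∨ f x = 1) :
    ∑ S, (S.card : ℝ) * biasedCoeff p f S ^ 2 ≤ ∑ i, biasedMean p (cubeDeriv i f) := by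
  have : ∀ S : Finset ι, (S.card : ℝ) * biasedCoeff p f S ^ 2 =
      ∑ i, if i ∈ S ∧ True then biasedCoeff p f S ^ 2 else 0 := fun S => by
    simp
  simp only [this]
  rw [sum_comm]
  refine sum_le_sum fun i _ => ?_
  rw [sum_biasedCoeff_sq_mem h0 h1 f i fun _ => True]
  calc _ ≤ 1 * ∑ S, biasedCoeff p (cubeDeriv i f) S ^ 2 :=
        mul_le_mul (by nlinarith) (sum_le_sum_of_subset_of_nonneg (subset_univ _)
          fun _ _ _ => sq_nonneg _) (sum_nonneg fun _ _ => sq_nonneg _) one_pos.le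
    _ = _ := by
        rw [one_mul, sum_sq_biasedCoeff h0 h1]
        simp only [cubeDeriv_sq_eq hf h01]

/-- Friedgut's junta theorem for increasing functions, with explicit parameters. -/
theorem biasedMean_sq_sub_junta_le {p : ℝ} (hp : p ∈ Set.Icc (1 / 4 : ℝ) (1 / 2))
    {f : Finset ι → ℝ} (hf : Monotone f) (h01 : ∀ x, f x = 0 ∨ f x = 1) {M : ℝ}
    (hM : ∑ i, biasedMean p (cubeDeriv i f) ≤ M) {d : ℕ} (hd : 0 < d) {θ : ℝ} (hθ : 0 ≤ θ)
    {J : Finset ι} (hJ : ∀ i ∉ J, biasedMean p (cubeDeriv i f) * 81 ^ d ≤ θ ^ 2) :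
    biasedMean p (fun x => (f x - ∑ S ∈ J.powerset, biasedCoeff p f S * biasedChar p S x) ^ 2) ≤
      M / d + θ * M := by
  have h0 : 0 < p := by linarith [hp.1]
  have h1 : p < 1 := by linarith [hp.2]
  have hd' : (0 : ℝ) < d := Nat.cast_pos.2 hd
  have hD0 : ∀ i, 0 ≤ biasedMean p (cubeDeriv i f) := fun i =>
    biasedMean_nonneg h0.le h1.le fun x => cubeDeriv_sq_eq hf h01 i x ▸ sq_nonneg _
  have hsub : ∀ x, f x - ∑ S ∈ J.powerset, biasedCoeff p f S * biasedChar p S x =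
      ∑ S ∈ univ \ J.powerset, biasedCoeff p f S * biasedChar p S x := fun x => by
    rw [← sum_biasedCoeff_char h0 h1 f x, ← sum_sdiff (subset_univ J.powerset)]
    ring
  simp only [hsub]
  rw [biasedMean_sq_sum_char h0 h1]
  -- A character outside `J.powerset` either has degree above `d`, paid for by total influence, or
  -- has low degree and contains a coordinate outside `J`.
  have hpt : ∀ S ∈ univ \ J.powerset, biasedCoeff p f S ^ 2 ≤
      (S.card : ℝ) * biasedCoeff p f S ^ 2 / d +
        ∑ i ∈ univ \ J, if i ∈ S ∧ S.card ≤ d then biasedCoeff p f S ^ 2 else 0 := by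
    intro S hS
    have hnn : ∀ i ∈ univ \ J, 0 ≤ if i ∈ S ∧ S.card ≤ d then biasedCoeff p f S ^ 2 else 0 :=
      fun i _ => by split_ifs <;> positivity
    obtain hc | hc := le_or_gt S.card d
    · obtain ⟨i, hiS, hiJ⟩ : ∃ i ∈ S, i ∉ J := by
        simpa [Finset.not_subset] using hS
      have := single_le_sum hnn (mem_sdiff.2 ⟨mem_univ i, hiJ⟩)
      rw [if_pos ⟨hiS, hc⟩] at this
      have : 0 ≤ (S.card : ℝ) * biasedCoeff p f S ^ 2 / d := by positivity
      linarith
    · have h2 : biasedCoeff p f S ^ 2 ≤ (S.card : ℝ) * biasedCoeff p f S ^ 2 / d := by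
        rw [le_div_iff₀ hd', mul_comm]
        exact mul_le_mul_of_nonneg_right (by exact_mod_cast hc.le) (sq_nonneg _)
      linarith [sum_nonneg hnn]
  have hlow : ∀ i ∈ univ \ J,
      ∑ S, (if i ∈ S ∧ S.card ≤ d then biasedCoeff p f S ^ 2 else 0) ≤
        θ * biasedMean p (cubeDeriv i f) := by
    intro i hi
    rw [sum_biasedCoeff_sq_mem h0 h1 f i fun c => c ≤ d]
    set 𝒮 := (univ.erase i).powerset.filter fun S : Finset ι => S.card + 1 ≤ d
    have hlev := sq_sum_sq_biasedCoeff_le hp (cubeDeriv_sq_eq hf h01 i) (d := d) (𝒮 := 𝒮)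
      fun S hS => by have := (mem_filter.1 hS).2; omega
    have hle : ∑ S ∈ 𝒮, biasedCoeff p (cubeDeriv i f) S ^ 2 ≤
        θ * biasedMean p (cubeDeriv i f) := by
      refine abs_le_of_sq_le_sq' ?_ (mul_nonneg hθ (hD0 i)) |>.2
      calc _ ≤ _ := hlev
        _ = biasedMean p (cubeDeriv i f) ^ 2 * (biasedMean p (cubeDeriv i f) * 81 ^ d) := by ring
        _ ≤ biasedMean p (cubeDeriv i f) ^ 2 * θ ^ 2 :=
          mul_le_mul_of_nonneg_left (hJ i (mem_sdiff.1 hi).2) (sq_nonneg _)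
        _ = _ := by ring
    have h3 : 0 ≤ ∑ S ∈ 𝒮, biasedCoeff p (cubeDeriv i f) S ^ 2 := sum_nonneg fun _ _ => sq_nonneg _
    exact (mul_le_of_le_one_left h3 (by nlinarith)).trans hle
  calc ∑ S ∈ univ \ J.powerset, biasedCoeff p f S ^ 2
      ≤ ∑ S ∈ univ \ J.powerset, ((S.card : ℝ) * biasedCoeff p f S ^ 2 / d +
        ∑ i ∈ univ \ J, if i ∈ S ∧ S.card ≤ d then biasedCoeff p f S ^ 2 else 0) :=
        sum_le_sum hpt
    _ ≤ ∑ S, ((S.card : ℝ) * biasedCoeff p f S ^ 2 / d +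
        ∑ i ∈ univ \ J, if i ∈ S ∧ S.card ≤ d then biasedCoeff p f S ^ 2 else 0) := by
        refine sum_le_sum_of_subset_of_nonneg (subset_univ _) fun S _ _ => ?_
        refine add_nonneg (by positivity) (sum_nonneg fun i _ => ?_)
        split_ifs <;> positivity
    _ = (∑ S, (S.card : ℝ) * biasedCoeff p f S ^ 2) / d +
        ∑ i ∈ univ \ J, ∑ S, if i ∈ S ∧ S.card ≤ d then biasedCoeff p f S ^ 2 else 0 := by
        rw [sum_add_distrib, sum_div, sum_comm]
    _ ≤ M / d + ∑ i ∈ univ \ J, θ * biasedMean p (cubeDeriv i f) := by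
        refine add_le_add ?_ (sum_le_sum hlow)
        gcongr
        exact (sum_card_mul_sq_biasedCoeff_le h0 h1 hf h01).trans hM
    _ ≤ M / d + θ * M := by
        rw [← mul_sum]
        gcongr
        exact (sum_le_sum_of_subset_of_nonneg (subset_univ _) fun i _ _ => hD0 i).trans hM

/-- An increasing `0-1` function of bounded total influence which has mean at least `c` on every
subcube obtained by putting boundedly many coordinates equal to zero has mean close to one. -/
theorem exists_one_sub_le_biasedMean (M η c : ℝ) (hM : 0 < M) (hη : 0 < η) (hc : 0 < c) :
    ∃ h : ℕ, ∀ (ι : Type) [Fintype ι] [DecidableEq ι] (p : ℝ), p ∈ Set.Icc (1 / 4 : ℝ) (1 / 2) →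
      ∀ f : Finset ι → ℝ, Monotone f → (∀ x, f x = 0 ∨ f x = 1) →
      ∑ i, biasedMean p (cubeDeriv i f) ≤ M →
      (∀ J : Finset ι, J.card ≤ h → c ≤ biasedMean p fun y => f (y \ J)) →
      1 - η ≤ biasedMean p f := by
  have hη' : 0 < c ^ 2 * η := by positivity
  obtain ⟨d, hd⟩ := exists_nat_gt (2 * M / (c ^ 2 * η))
  have hd0 : (0 : ℝ) < d := lt_trans (by positivity) hd
  -- With this `d` and `θ`, each of the two error terms is at most `c² η / 2`.
  set θ : ℝ := c ^ 2 * η / (2 * M) with hθ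
  have hθ0 : 0 < θ := by positivity
  obtain ⟨h, hh⟩ := exists_nat_ge (M * 81 ^ d / θ ^ 2)
  refine ⟨h, fun ι _ _ p hp f hf h01 hI hJ => ?_⟩
  have h0 : 0 < p := by linarith [hp.1]
  have h1 : p < 1 := by linarith [hp.2]
  have hD0 : ∀ i, 0 ≤ biasedMean p (cubeDeriv i f) := fun i =>
    biasedMean_nonneg h0.le h1.le fun x => cubeDeriv_sq_eq hf h01 i x ▸ sq_nonneg _
  -- The influential coordinates; the bound on total influence leaves at most `h` of them.
  set J : Finset ι := univ.filter fun i => θ ^ 2 < biasedMean p (cubeDeriv i f) * 81 ^ d with hJd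
  have hcard : J.card ≤ h := by
    have : (J.card : ℝ) * θ ^ 2 ≤ M * 81 ^ d :=
      calc (J.card : ℝ) * θ ^ 2 = ∑ i ∈ J, θ ^ 2 := by simp
        _ ≤ ∑ i ∈ J, biasedMean p (cubeDeriv i f) * 81 ^ d :=
          sum_le_sum fun i hi => (mem_filter.1 hi).2.le
        _ ≤ ∑ i, biasedMean p (cubeDeriv i f) * 81 ^ d :=
          sum_le_sum_of_subset_of_nonneg (subset_univ _) fun i _ _ =>
            mul_nonneg (hD0 i) (by positivity)
        _ ≤ M * 81 ^ d := by rw [← sum_mul]; gcongr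
    have h2 : (J.card : ℝ) ≤ M * 81 ^ d / θ ^ 2 := by rwa [le_div_iff₀ (by positivity)]
    exact_mod_cast h2.trans hh
  have hfri := biasedMean_sq_sub_junta_le hp hf h01 hI (Nat.cast_pos.1 hd0) hθ0.le (J := J)
    fun i hi => by simpa [hJd] using hi
  have hbound : M / d + θ * M ≤ c ^ 2 * η := by
    have e1 : θ * M = c ^ 2 * η / 2 := by rw [hθ]; field_simp
    have e2 : M / d ≤ c ^ 2 * η / 2 := by
      rw [div_lt_iff₀ hη'] at hd
      rw [div_le_iff₀ hd0]
      linarith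
    linarith
  -- Where `f = 0` the projection is at least `c`, so the squared error is at least `c²`.
  have hlow : c ^ 2 * biasedMean p (fun x => 1 - f x) ≤ c ^ 2 * η := by
    refine le_trans ?_ (hfri.trans hbound)
    rw [← biasedMean_const_mul]
    refine biasedMean_mono h0.le h1.le fun x => ?_
    have hge := (hJ J hcard).trans (biasedMean_sdiff_le h0 h1 hf J x)
    obtain hx | hx := h01 x <;> rw [hx]
    · nlinarith
    · nlinarith [sq_nonneg (1 - ∑ S ∈ J.powerset, biasedCoeff p f S * biasedChar p S x)]
  have hle := le_of_mul_le_mul_left hlow (by positivity)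
  have hsplit := biasedMean_add p (fun x => 1 - f x) f
  simp only [sub_add_cancel, biasedMean_one] at hsplit
  linarith

end Junta

/-! ### The Margulis-Russo formula and a point of small total influence. -/

section Russo

variable {ι : Type*} [Fintype ι] [DecidableEq ι]

/-- The Margulis-Russo formula. -/
theorem hasDerivAt_biasedMean (f : Finset ι → ℝ) (p : ℝ) :
    HasDerivAt (fun q => biasedMean q f) (∑ i, biasedMean p (cubeDeriv i f)) p := by
  have hw : ∀ x : Finset ι, HasDerivAt (fun q => biasedWeight q x)
      (∑ i, (∏ j ∈ univ.erase i, if j ∈ x then p else 1 - p) * if i ∈ x then 1 else -1) p := by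
    intro x
    refine HasDerivAt.fun_finsetProd (f := fun i q => if i ∈ x then q else 1 - q) fun i _ => ?_
    split_ifs
    · exact hasDerivAt_id p
    · simpa using (hasDerivAt_id p).const_sub 1
  have hs : HasDerivAt (fun q => biasedMean q f) (∑ x : Finset ι,
      (∑ i, (∏ j ∈ univ.erase i, if j ∈ x then p else 1 - p) * if i ∈ x then 1 else -1) * f x) p :=
    HasDerivAt.fun_sum fun x _ => (hw x).mul_const (f x)
  convert hs using 1
  simp only [sum_mul]
  rw [sum_comm]
  refine sum_congr rfl fun i _ => ?_
  rw [biasedMean, sum_finset_eq_pairs i, sum_finset_eq_pairs i]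
  refine sum_congr rfl fun x hx => ?_
  have hi : i ∉ x := fun h => by simpa using mem_powerset.1 hx h
  have hprod : (∏ j ∈ univ.erase i, if j ∈ insert i x then p else 1 - p) =
      ∏ j ∈ univ.erase i, if j ∈ x then p else 1 - p :=
    prod_congr rfl fun j hj => by simp [(mem_erase.1 hj).1]
  rw [biasedWeight_of_notMem p hi, biasedWeight_insert, hprod, cubeDeriv, cubeDeriv, insert_idem,
    erase_eq_of_notMem hi, erase_insert hi, if_neg hi, if_pos (mem_insert_self i x)]
  ring

/-- The mean stays in `[0, 1]`, so its slope is at most `1 / (b - a)` somewhere; nonnegative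
influences make it increasing. -/
theorem exists_sum_mean_cubeDeriv_le {f : Finset ι → ℝ} (hf : Monotone f)
    (h01 : ∀ x, f x = 0 ∨ f x = 1) {a b : ℝ} (h0 : 0 ≤ a) (hab : a < b) (h1 : b ≤ 1) :
    ∃ p ∈ Set.Ioo a b, ∑ i, biasedMean p (cubeDeriv i f) ≤ 1 / (b - a) ∧
      biasedMean p f ≤ biasedMean b f := by
  have hcont : ∀ s, ContinuousOn (fun q => biasedMean q f) s := fun s q _ =>
    (hasDerivAt_biasedMean f q).continuousAt.continuousWithinAt
  have hb1 : ∀ q, 0 ≤ q → q ≤ 1 → biasedMean q f ≤ 1 := fun q hq0 hq1 => by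
    rw [← biasedMean_one (ι := ι) q]
    exact biasedMean_mono hq0 hq1 fun x => by obtain h | h := h01 x <;> rw [h]; norm_num
  have hb0 : ∀ q, 0 ≤ q → q ≤ 1 → 0 ≤ biasedMean q f := fun q hq0 hq1 =>
    biasedMean_nonneg hq0 hq1 fun x => by obtain h | h := h01 x <;> rw [h]; norm_num
  obtain ⟨p, hp, hpe⟩ := exists_hasDerivAt_eq_slope (fun q => biasedMean q f) _ hab (hcont _)
    fun q _ => hasDerivAt_biasedMean f q
  refine ⟨p, hp, ?_, ?_⟩
  · rw [hpe]
    have : 0 < b - a := by linarith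
    gcongr
    linarith [hb1 b (by linarith) h1, hb0 a h0 (by linarith)]
  · obtain ⟨q, hq, hqe⟩ := exists_hasDerivAt_eq_slope (fun q => biasedMean q f) _ hp.2 (hcont _)
      fun q _ => hasDerivAt_biasedMean f q
    have hnn : 0 ≤ ∑ i, biasedMean q (cubeDeriv i f) := sum_nonneg fun i _ =>
      biasedMean_nonneg (by linarith [hq.1, hp.1]) (by linarith [hq.2]) fun x =>
        cubeDeriv_sq_eq hf h01 i x ▸ sq_nonneg _
    rw [hqe, le_div_iff₀ (by linarith [hp.2])] at hnn
    linarith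

end Russo

/-! ### From uniform measure on a layer to biased measure. -/

section Layers

variable {ι : Type*} [Fintype ι] [DecidableEq ι]

theorem exists_perm_map_eq {Y S S' : Finset ι} (hS : S ⊆ Y) (hS' : S' ⊆ Y)
    (h : S.card = S'.card) :
    ∃ σ : Equiv.Perm ι, S.map σ.toEmbedding = S' ∧ Y.map σ.toEmbedding = Y := by
  let e : {y : {x // x ∈ Y} // y.1 ∈ S} ≃ {y : {x // x ∈ Y} // y.1 ∈ S'} :=
    (Equiv.subtypeSubtypeEquivSubtype (p := (· ∈ Y)) (q := (· ∈ S)) fun hx => hS hx).trans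
      ((Finset.equivOfCardEq h).trans
        (Equiv.subtypeSubtypeEquivSubtype (p := (· ∈ Y)) (q := (· ∈ S')) fun hx => hS' hx).symm)
  let τ : Equiv.Perm {x // x ∈ Y} := e.extendSubtype
  refine ⟨Equiv.Perm.ofSubtype τ, ?_, ?_⟩
  · refine eq_of_subset_of_card_le (fun x hx => ?_) (by rw [card_map, h])
    obtain ⟨y, hy, rfl⟩ := mem_map.1 hx
    have := e.extendSubtype_mem ⟨y, hS hy⟩ hy
    simpa [Equiv.Perm.ofSubtype_apply_of_mem τ (hS hy)] using this
  · refine eq_of_subset_of_card_le (fun x hx => ?_) (by rw [card_map])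
    obtain ⟨y, hy, rfl⟩ := mem_map.1 hx
    simp [Equiv.Perm.ofSubtype_apply_of_mem τ hy]

theorem biasedWeight_map (p : ℝ) (σ : Equiv.Perm ι) (x : Finset ι) :
    biasedWeight p (x.map σ.toEmbedding) = biasedWeight p x := by
  rw [biasedWeight, biasedWeight, ← Equiv.prod_comp σ]
  simp

theorem biasedMean_map (p : ℝ) (σ : Equiv.Perm ι) (f : Finset ι → ℝ) :
    biasedMean p (fun x => f (x.map σ.toEmbedding)) = biasedMean p f := by
  rw [biasedMean, biasedMean, ← Equiv.sum_comp (Equiv.finsetCongr σ) fun x =>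
    biasedWeight p x * f x]
  exact sum_congr rfl fun x _ => by rw [Equiv.finsetCongr_apply, biasedWeight_map]

open Classical in
/-- The biased measure of an up-closure is at least the density of the generating family, up to the
probability that a random set is too small. -/
theorem uniformMeasure_mul_le_biasedMean {p : ℝ} (h0 : 0 ≤ p) (h1 : p ≤ 1) {Y : Finset ι} {k : ℕ}
    (hk : k ≤ Y.card) {𝒮 : Finset (Finset ι)} (h𝒮 : 𝒮 ⊆ powersetCard k Y) :
    uniformMeasure Y k 𝒮 * biasedMean p (fun z => if k ≤ (z ∩ Y).card then 1 else 0) ≤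
      biasedMean p fun z => if ∃ S ∈ 𝒮, S ⊆ z then 1 else 0 := by
  -- `G S z` is the chance that a uniform `k`-subset of `z ∩ Y` equals `S`, and 0 if there is no
  -- such subset.
  set G : Finset ι → Finset ι → ℝ := fun S z =>
    if S ⊆ z ∧ k ≤ (z ∩ Y).card then (((z ∩ Y).card.choose k : ℕ) : ℝ)⁻¹ else 0 with hG
  have hcount : ∀ 𝒯 : Finset (Finset ι), ∀ z : Finset ι, k ≤ (z ∩ Y).card →
      ∑ S ∈ 𝒯, G S z =
        ((𝒯.filter fun S => S ⊆ z).card : ℝ) * (((z ∩ Y).card.choose k : ℕ) : ℝ)⁻¹ := by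
    intro 𝒯 z hz
    simp only [hG, hz, and_true]
    rw [← sum_filter, sum_const, nsmul_eq_mul]
  have hfilt : ∀ z : Finset ι, (powersetCard k Y).filter (fun S => S ⊆ z) =
      powersetCard k (z ∩ Y) := fun z => by
    ext S
    simp only [mem_filter, mem_powersetCard, subset_inter_iff]
    tauto
  have hchoose : ∀ z : Finset ι, k ≤ (z ∩ Y).card →
      (0 : ℝ) < (((z ∩ Y).card.choose k : ℕ) : ℝ) := fun z hz =>
    Nat.cast_pos.2 (Nat.choose_pos hz)
  have hzero : ∀ 𝒯 : Finset (Finset ι), ∀ z : Finset ι, ¬k ≤ (z ∩ Y).card →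
      ∑ S ∈ 𝒯, G S z = 0 := fun 𝒯 z hz => by simp [hG, hz]
  -- Permutations preserving `Y` make all `k`-subsets equally likely.
  have hsymm : ∀ S ∈ powersetCard k Y, ∀ S' ∈ powersetCard k Y,
      biasedMean p (G S) = biasedMean p (G S') := by
    intro S hS S' hS'
    rw [mem_powersetCard] at hS hS'
    obtain ⟨σ, hσS, hσY⟩ := exists_perm_map_eq hS.1 hS'.1 (hS.2.trans hS'.2.symm)
    rw [← biasedMean_map p σ (G S')]
    congr 1
    funext z
    have hc : (z.map σ.toEmbedding ∩ Y).card = (z ∩ Y).card := by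
      conv_lhs => rw [← hσY, ← map_inter, card_map]
    simp only [hG, hc, ← hσS, map_subset_map]
  obtain ⟨S₀, hS₀⟩ := powersetCard_nonempty.2 hk
  have hsum : ∀ 𝒯 ⊆ powersetCard k Y, biasedMean p (fun z => ∑ S ∈ 𝒯, G S z) =
      𝒯.card * biasedMean p (G S₀) := by
    intro 𝒯 h𝒯
    rw [biasedMean_sum, sum_congr rfl fun S hS => hsymm S (h𝒯 hS) S₀ hS₀, sum_const, nsmul_eq_mul]
  have hfull : biasedMean p (fun z => if k ≤ (z ∩ Y).card then (1 : ℝ) else 0) =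
      (Y.card.choose k : ℕ) * biasedMean p (G S₀) := by
    rw [← card_powersetCard, ← hsum _ Subset.rfl]
    congr 1
    funext z
    split_ifs with hz
    · rw [hcount _ z hz, hfilt, card_powersetCard, mul_inv_cancel₀ (hchoose z hz).ne']
    · rw [hzero _ z hz]
  have hY : (0 : ℝ) < ((Y.card.choose k : ℕ) : ℝ) := Nat.cast_pos.2 (Nat.choose_pos hk)
  rw [hfull, uniformMeasure, ← mul_assoc, div_mul_cancel₀ _ hY.ne', ← hsum 𝒮 h𝒮]
  refine biasedMean_mono h0 h1 fun z => ?_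
  by_cases hz : k ≤ (z ∩ Y).card
  · rw [hcount 𝒮 z hz]
    split_ifs with hex
    · rw [← div_eq_mul_inv, div_le_one (hchoose z hz), ← card_powersetCard, ← hfilt]
      exact_mod_cast card_le_card (filter_subset_filter _ h𝒮)
    · rw [filter_eq_empty_iff.2 fun S hS hSz => hex ⟨S, hS, hSz⟩]
      simp
  · rw [hzero 𝒮 z hz]
    split_ifs <;> norm_num

/-- The centred count is `√(p (1 - p))` times a sum of degree-one characters, so Parseval gives the
variance. -/
theorem biasedMean_sq_card_sub {p : ℝ} (h0 : 0 < p) (h1 : p < 1) (Y : Finset ι) :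
    biasedMean p (fun z => (((z ∩ Y).card : ℝ) - p * Y.card) ^ 2) = p * (1 - p) * Y.card := by
  have hσ := (sqrt_mul_one_sub_pos h0 h1).ne'
  have hpar := biasedMean_sq_sum_char h0 h1
    (Y.map ⟨fun i => ({i} : Finset ι), singleton_injective⟩) fun _ => 1
  simp only [sum_map, Function.Embedding.coeFn_mk, biasedChar, prod_singleton, one_mul, one_pow,
    sum_const, nsmul_eq_mul, mul_one, card_map] at hpar
  refine Eq.trans ?_ (congrArg (p * (1 - p) * ·) hpar)
  rw [← sq_sqrt_mul_one_sub h0 h1, ← biasedMean_const_mul]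
  congr 1
  funext z
  rw [← mul_pow, mul_sum]
  congr 1
  have : ∀ i ∈ Y, √(p * (1 - p)) * biasedCoord p i z = (if i ∈ z then 1 else 0) - p := fun i _ => by
    rw [biasedCoord]
    split_ifs <;> field_simp
    ring
  rw [sum_congr rfl this, sum_sub_distrib, sum_const, nsmul_eq_mul, inter_comm, mul_comm,
    ← filter_mem_eq_inter, card_filter]
  simp

/-- Chebyshev's inequality. -/
theorem one_sub_le_biasedMean_card_ge {p : ℝ} (h0 : 0 < p) (h1 : p < 1) (Y : Finset ι) {k : ℕ}
    {s : ℝ} (hs : 0 < s) (hk : k + s ≤ p * Y.card) :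
    1 - Y.card / s ^ 2 ≤ biasedMean p (fun z => if k ≤ (z ∩ Y).card then 1 else 0) := by
  have hle : s ^ 2 * biasedMean p (fun z => 1 - if k ≤ (z ∩ Y).card then (1 : ℝ) else 0) ≤
      Y.card := by
    rw [← biasedMean_const_mul]
    calc _ ≤ biasedMean p (fun z => (((z ∩ Y).card : ℝ) - p * Y.card) ^ 2) := by
          refine biasedMean_mono h0.le h1.le fun z => ?_
          split_ifs with hz
          · simpa using sq_nonneg _
          · have : ((z ∩ Y).card : ℝ) ≤ k := by exact_mod_cast (not_le.1 hz).le
            nlinarith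
      _ = p * (1 - p) * Y.card := biasedMean_sq_card_sub h0 h1 Y
      _ ≤ 1 * Y.card := mul_le_mul_of_nonneg_right (by nlinarith) (Nat.cast_nonneg _)
      _ = _ := one_mul _
  have hsplit := biasedMean_add p
    (fun z : Finset ι => 1 - if k ≤ (z ∩ Y).card then (1 : ℝ) else 0)
    (fun z => if k ≤ (z ∩ Y).card then 1 else 0)
  simp only [sub_add_cancel, biasedMean_one] at hsplit
  rw [mul_comm, ← le_div_iff₀ (by positivity)] at hle
  linarith

end Layers

/-! ### Quasirandom families and the conclusion. -/

open Classical in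
/-- The up-closure, away from a fixed set `T`, of a slice-quasirandom family has measure more than
one half under the uniform measure on the cube. -/
theorem SliceQuasirandom.half_lt_biasedMean (ε ζ : ℝ) (hε : 0 < ε) (hζ : 0 < ζ) (hζ' : ζ ≤ 1 / 4)
    (r : ℕ) :
    ∃ h₀ n₀ : ℕ, ∀ n : ℕ, n₀ ≤ n → ∀ k : ℕ, r ≤ k → (k : ℝ) ≤ (1 / 2 - ζ) * (n : ℝ) →
      ∀ 𝒜 : Finset (Finset (Fin n)), 𝒜 ⊆ powersetCard k univ →
        SliceQuasirandom univ k (ε / 5) h₀ 𝒜 → ε ≤ uniformMeasure univ k 𝒜 →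
        ∀ T : Finset (Fin n), T.card = r →
        1 / 2 < biasedMean (1 / 2) fun z => if ∃ A ∈ 𝒜, T ⊆ A ∧ A \ T ⊆ z then 1 else 0 := by
  -- Here `2 / ζ` is the inverse length of `[1/2 - ζ/2, 1/2]`, and `2ε/5` is the slice density
  -- `4ε/5` times a Chebyshev probability of 1/2.
  obtain ⟨h, hh⟩ := exists_one_sub_le_biasedMean (2 / ζ) (1 / 4) (2 * ε / 5) (by positivity)
    (by norm_num) (by positivity)
  set H : ℝ := ((h + r : ℕ) : ℝ) with hH
  have hH0 : 0 ≤ H := Nat.cast_nonneg _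
  -- The first term keeps a margin `ζ n / 4` after deleting `J ∪ T`; the second brings the Chebyshev
  -- error below 1/2.
  obtain ⟨n₀, hn₀⟩ := exists_nat_ge (2 * H / ζ + 32 / ζ ^ 2)
  refine ⟨h + r, n₀, fun n hn k hrk hk 𝒜 h𝒜 hqr hμ T hT => ?_⟩
  set f : Finset (Fin n) → ℝ := fun z => if ∃ A ∈ 𝒜, T ⊆ A ∧ A \ T ⊆ z then 1 else 0 with hf
  have hmono : Monotone f := fun x y hxy => by
    simp only [hf]
    split_ifs with hx hy hy
    · rfl
    · obtain ⟨A, hA, hTA, hAx⟩ := hx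
      exact absurd ⟨A, hA, hTA, hAx.trans hxy⟩ hy
    · norm_num
    · rfl
  have h01 : ∀ x, f x = 0 ∨ f x = 1 := fun x => by
    simp only [hf]
    split_ifs <;> simp
  obtain ⟨p, hp, hpI, hpf⟩ := exists_sum_mean_cubeDeriv_le hmono h01 (a := 1 / 2 - ζ / 2)
    (b := 1 / 2) (by linarith) (by linarith) (by norm_num)
  have h0 : 0 < p := by linarith [hp.1]
  have h1 : p < 1 := by linarith [hp.2]
  have hn1 : 2 * H / ζ + 32 / ζ ^ 2 ≤ n := hn₀.trans (by exact_mod_cast hn)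
  have hpos1 : 0 ≤ 2 * H / ζ := by positivity
  have hpos2 : 0 < 32 / ζ ^ 2 := by positivity
  have hnpos : (0 : ℝ) < n := by linarith
  have hnH : 2 * H ≤ ζ * n := by
    have : 2 * H / ζ ≤ n := by linarith
    rwa [div_le_iff₀ hζ, mul_comm (n : ℝ)] at this
  have hnζ : 32 ≤ ζ ^ 2 * n := by
    have : 32 / ζ ^ 2 ≤ n := by linarith
    rwa [div_le_iff₀ (by positivity), mul_comm (n : ℝ)] at this
  have hslice : ∀ J : Finset (Fin n), J.card ≤ h → 2 * ε / 5 ≤ biasedMean p fun y => f (y \ J) := by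
    intro J hJ
    have hJT : (J ∪ T).card ≤ h + r := (card_union_le J T).trans (by omega)
    have hYcard : (univ \ (J ∪ T)).card = n - (J ∪ T).card := by
      rw [card_sdiff_of_subset (subset_univ _), card_univ, Fintype.card_fin]
    have hYn : n ≤ (univ \ (J ∪ T)).card + (h + r) := by omega
    have hYn' : (n : ℝ) ≤ (univ \ (J ∪ T)).card + H := by
      rw [hH]
      exact_mod_cast hYn
    have hYle : ((univ \ (J ∪ T)).card : ℝ) ≤ n := by
      exact_mod_cast hYcard.trans_le (Nat.sub_le _ _)
    have hkr : ((k - r : ℕ) : ℝ) ≤ k := by exact_mod_cast Nat.sub_le k r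
    have hkY : ((k - r : ℕ) : ℝ) + ζ * n / 4 ≤ p * (univ \ (J ∪ T)).card := by
      have : (1 / 2 - ζ / 2) * (n - H) ≤ p * (univ \ (J ∪ T)).card :=
        mul_le_mul hp.1.le (by linarith) (by nlinarith) h0.le
      nlinarith
    have hkY' : k - r ≤ (univ \ (J ∪ T)).card := by
      have h3 : p * (univ \ (J ∪ T)).card ≤ (univ \ (J ∪ T)).card :=
        mul_le_of_le_one_left (Nat.cast_nonneg _) h1.le
      have : ((k - r : ℕ) : ℝ) ≤ (univ \ (J ∪ T)).card := by
        have : 0 ≤ ζ * n / 4 := by positivity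
        linarith
      exact_mod_cast this
    -- Trace `T` on `J ∪ T` means that `A` contains `T` and `A \ T` misses `J`.
    have hq := hqr (J ∪ T) (subset_univ _) hJT T subset_union_right (hT ▸ hrk) (hT ▸ hkY')
    rw [hT, abs_lt] at hq
    have hfam : sliceFamily 𝒜 (J ∪ T) T ⊆ powersetCard (k - r) (univ \ (J ∪ T)) := by
      intro S hS
      obtain ⟨A, hA, rfl⟩ := mem_image.1 hS
      obtain ⟨hA, hAT⟩ := mem_filter.1 hA
      have hTA : T ⊆ A := hAT ▸ inter_subset_left
      rw [mem_powersetCard, card_sdiff_of_subset hTA, (mem_powersetCard.1 (h𝒜 hA)).2, hT]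
      refine ⟨fun x hx => ?_, rfl⟩
      obtain ⟨hxA, hxT⟩ := mem_sdiff.1 hx
      refine mem_sdiff.2 ⟨mem_univ x, fun hxJ => hxT ?_⟩
      rw [← hAT]
      exact mem_inter.2 ⟨hxA, hxJ⟩
    have hup := uniformMeasure_mul_le_biasedMean h0.le h1.le hkY' hfam
    have hcheb := one_sub_le_biasedMean_card_ge h0 h1 (univ \ (J ∪ T)) (by positivity) hkY
    have hhalf : ((univ \ (J ∪ T)).card : ℝ) / (ζ * n / 4) ^ 2 ≤ 1 / 2 := by
      rw [div_le_iff₀ (by positivity)]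
      nlinarith
    calc 2 * ε / 5 = 4 * ε / 5 * (1 / 2) := by ring
      _ ≤ uniformMeasure (univ \ (J ∪ T)) (k - r) (sliceFamily 𝒜 (J ∪ T) T) *
          biasedMean p (fun z => if k - r ≤ (z ∩ (univ \ (J ∪ T))).card then 1 else 0) :=
        mul_le_mul (by linarith [hq.1]) (by linarith) (by norm_num) (by linarith [hq.1])
      _ ≤ _ := hup
      _ ≤ _ := by
        refine biasedMean_mono h0.le h1.le fun z => ?_
        split_ifs with hz
        · obtain ⟨S, hS, hSz⟩ := hz
          have hSY := (mem_powersetCard.1 (hfam hS)).1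
          obtain ⟨A, hA, rfl⟩ := mem_image.1 hS
          obtain ⟨hA, hAT⟩ := mem_filter.1 hA
          refine le_of_eq (if_pos ⟨A, hA, hAT ▸ inter_subset_left, fun x hx => ?_⟩).symm
          refine mem_sdiff.2 ⟨hSz hx, fun hxJ => ?_⟩
          exact (mem_sdiff.1 (hSY hx)).2 (mem_union_left T hxJ)
        · obtain h | h := h01 (z \ J) <;> rw [h]
          norm_num
  have hM : ∑ i, biasedMean p (cubeDeriv i f) ≤ 2 / ζ := by
    refine hpI.trans (le_of_eq ?_)
    rw [show 1 / 2 - (1 / 2 - ζ / 2) = ζ / 2 by ring, one_div_div]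
  have := hh (Fin n) p ⟨by linarith [hp.1], hp.2.le⟩ f hmono h01 hM hslice
  linarith

theorem exists_one_lt_add_compl {n : ℕ} (f g : Finset (Fin n) → ℝ)
    (hf : 1 / 2 < biasedMean (1 / 2) f) (hg : 1 / 2 < biasedMean (1 / 2) g) :
    ∃ z, 1 < f z + g zᶜ := by
  by_contra! hc
  have hw : ∀ z : Finset (Fin n), biasedWeight (1 / 2) zᶜ = biasedWeight (1 / 2) z := fun z =>
    prod_congr rfl fun i _ => by split_ifs <;> norm_num
  have hcompl : biasedMean (1 / 2) (fun z => g zᶜ) = biasedMean (1 / 2) g := by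
    rw [biasedMean, biasedMean, ← compl_involutive.bijective.sum_comp fun z =>
      biasedWeight (1 / 2) z * g z]
    exact sum_congr rfl fun z _ => by rw [hw]
  have := biasedMean_mono (by norm_num) (by norm_num : (1 / 2 : ℝ) ≤ 1) hc
  rw [biasedMean_add, biasedMean_one, hcompl] at this
  linarith

theorem mainTheorem7 (ε ζ : ℝ) (hε : ε ∈ Set.Ioo (0 : ℝ) 1) (hζ : ζ ∈ Set.Ioo (0 : ℝ) 1)
    (t : ℕ) (ht : 1 ≤ t) :
    ∃ h₀ n₀ : ℕ, ∀ n : ℕ, n₀ ≤ n → ∀ k₁ k₂ : ℕ,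
      t - 1 ≤ k₁ → t - 1 ≤ k₂ →
      (k₁ : ℝ) ≤ (1 / 2 - ζ) * (n : ℝ) → (k₂ : ℝ) ≤ (1 / 2 - ζ) * (n : ℝ) →
      ∀ 𝒜 ℬ : Finset (Finset (Fin n)),
        𝒜 ⊆ Finset.powersetCard k₁ Finset.univ → ℬ ⊆ Finset.powersetCard k₂ Finset.univ →
        SliceQuasirandom Finset.univ k₁ (ε / 5) h₀ 𝒜 →
        SliceQuasirandom Finset.univ k₂ (ε / 5) h₀ ℬ →
        ε ≤ uniformMeasure Finset.univ k₁ 𝒜 → ε ≤ uniformMeasure Finset.univ k₂ ℬ →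
        ∃ A ∈ 𝒜, ∃ B ∈ ℬ, (A ∩ B).card = t - 1 := by
  -- Shrinking `ζ` only relaxes the bounds on `k₁` and `k₂`, and keeps `p` in `[1/4, 1/2]`.
  obtain ⟨h₀, n₀, hmain⟩ := SliceQuasirandom.half_lt_biasedMean ε (min ζ (1 / 4)) hε.1
    (lt_min hζ.1 (by norm_num)) (min_le_right _ _) (t - 1)
  refine ⟨h₀, max n₀ t, fun n hn k₁ k₂ htk₁ htk₂ hk₁ hk₂ 𝒜 ℬ h𝒜 hℬ hq𝒜 hqℬ hμ𝒜 hμℬ => ?_⟩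
  have hn₀ : n₀ ≤ n := (le_max_left _ _).trans hn
  have htn : t ≤ n := (le_max_right _ _).trans hn
  have hζn : (1 / 2 - ζ) * (n : ℝ) ≤ (1 / 2 - min ζ (1 / 4)) * n :=
    mul_le_mul_of_nonneg_right (by linarith [min_le_left ζ (1 / 4)]) (Nat.cast_nonneg n)
  obtain ⟨T, -, hT⟩ := exists_subset_card_eq (s := (univ : Finset (Fin n))) (n := t - 1)
    (by rw [card_univ, Fintype.card_fin]; omega)
  obtain ⟨z, hz⟩ := exists_one_lt_add_compl _ _
    (hmain n hn₀ k₁ htk₁ (hk₁.trans hζn) 𝒜 h𝒜 hq𝒜 hμ𝒜 T hT)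
    (hmain n hn₀ k₂ htk₂ (hk₂.trans hζn) ℬ hℬ hqℬ hμℬ T hT)
  -- Both values are 0 or 1, so a sum above 1 forces both to be 1.
  split_ifs at hz with hA hB hB
  · obtain ⟨A, hA, hTA, hAz⟩ := hA
    obtain ⟨B, hB, hTB, hBz⟩ := hB
    refine ⟨A, hA, B, hB, ?_⟩
    rw [← hT]
    congr 1
    refine Subset.antisymm (fun x hx => ?_) (subset_inter hTA hTB)
    obtain ⟨hxA, hxB⟩ := mem_inter.1 hx
    by_contra hxT
    exact mem_compl.1 (hBz (mem_sdiff.2 ⟨hxB, hxT⟩)) (hAz (mem_sdiff.2 ⟨hxA, hxT⟩))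
  all_goals norm_num at hz
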